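/- Let $a<b$ and let $\alpha:[a,b]\to\mathbb{R}^2$ be a regular closed plane curve, that is, $\alpha$ is twice continuously differentiable (with one-sided derivatives at the end points), $\alpha'(t)\neq 0$ for all $t\in[a,b]$, $\alpha(a)=\alpha(b)$ and $\alpha'(a)=\alpha'(b)$. Assume that $\alpha$ is simple, i.e. injective on $[a,b)$. Let $L(\gamma)=\int_a^b|\gamma'(t)|\,dt$ denote the length of a curve $\gamma:[a,b]\to\mathbb{R}^2$, let $\kappa=\det(\alpha',\alpha'')/|\alpha'|^3$ be the signed curvature of $\alpha$, let $\vec e(t)$ be the unit tangent vector $\alpha'(t)/|\alpha'(t)|$ rotated counter-clockwise by a right angle, and for $\varepsilon\ge 0$ let $\beta_\varepsilon=\alpha+\varepsilon\vec e$ be the (left) parallel curve of $\alpha$ at distance $\varepsilon$. Then there is a sign $\sigma\in\{1,-1\}$, depending only on $\alpha$, such that $$L(\beta_\varepsilon)-L(\alpha)=\sigma\cdot 2\pi\varepsilon$$ for every $\varepsilon\ge 0$ that does not exceed the radius of curvature $1/\kappa(t)$ at any $t\in[a,b]$ with $\kappa(t)>0$. In particular, there is $\varepsilon_0>0$ such that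 this equality holds for all $0\le\varepsilon\le\varepsilon_0$. -/

import Mathlib

noncomputable section

namespace PlaneCurve

/-- The Euclidean plane. -/
abbrev Plane : Type := EuclideanSpace ℝ (Fin 2)

/-- The velocity `α'(t)` of a curve defined on `[a, b]` (one-sided at the end points). -/
def velocity (a b : ℝ) (α : ℝ → Plane) (t : ℝ) : Plane :=
  derivWithin α (Set.Icc a b) t

/-- The second derivative `α''(t)` of a curve defined on `[a, b]` (one-sided at the end points). -/
def acceleration (a b : ℝ) (α : ℝ → Plane) (t : ℝ) : Plane :=
  derivWithin (velocity a b α) (Set.Icc a b) t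

/-- The length `∫_a^b |α'(t)| dt` of a curve defined on `[a, b]`. -/
def length (a b : ℝ) (α : ℝ → Plane) : ℝ :=
  ∫ t in a..b, ‖velocity a b α t‖

/-- The determinant of two plane vectors. -/
def det (u v : Plane) : ℝ := u 0 * v 1 - u 1 * v 0

/-- The signed curvature `det(α', α'') / |α'|³`. -/
def curvature (a b : ℝ) (α : ℝ → Plane) (t : ℝ) : ℝ :=
  det (velocity a b α t) (acceleration a b α t) / ‖velocity a b α t‖ ^ 3

/-- Counter-clockwise rotation by a right angle. -/
def rotate (v : Plane) : Plane := !₂[-(v 1), v 0]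

/-- The unit normal `e(t)`: the unit tangent `α'/|α'|` rotated counter-clockwise. -/
def leftNormal (a b : ℝ) (α : ℝ → Plane) (t : ℝ) : Plane :=
  rotate (‖velocity a b α t‖⁻¹ • velocity a b α t)

/-- The (left) parallel curve `β = α + ε e` at distance `ε`. -/
def parallel (a b : ℝ) (α : ℝ → Plane) (ε : ℝ) (t : ℝ) : Plane :=
  α t + ε • leftNormal a b α t

/-- A regular closed curve on `[a, b]`: twice continuously differentiable, with nowhere vanishing
velocity, and such that `α(a) = α(b)`, `α'(a) = α'(b)`. -/
structure IsRegularClosed (a b : ℝ) (α : ℝ → Plane) : Prop where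
  lt : a < b
  contDiffOn : ContDiffOn ℝ 2 α (Set.Icc a b)
  velocity_ne_zero : ∀ t ∈ Set.Icc a b, velocity a b α t ≠ 0
  closed : α a = α b
  velocity_closed : velocity a b α a = velocity a b α b

/-- A simple regular closed curve: no self-intersections apart from `α(a) = α(b)`. -/
structure IsSimpleRegularClosed (a b : ℝ) (α : ℝ → Plane) : Prop
    extends IsRegularClosed a b α where
  injOn : Set.InjOn α (Set.Ico a b)

end PlaneCurve

end

/-! The left normal satisfies `e' = -κ α'`, so the parallel curve has velocity `(1 - εκ) α'`. Up to
the radius of curvature this factor is nonnegative, and the lengths differ by `-ε ∫ κ |α'|`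
(`length_parallel_sub`). In complex notation `κ |α'| = Im (α''/α')`, so the integral is the turning
of the tangent, which is `±2π` by Hopf's argument (`exists_tangent_log`). The directions of all
chords have a continuous logarithm. Reversing a chord changes it by a constant, an odd multiple of
`πi`; two reversals lead from the tangent back to itself one period later; chords from a lowest
point force the odd factor to be `±1`. -/

noncomputable section

open Set Function

/-! ### Continuous logarithms and angles. -/

/-- A continuous logarithm of a constant is constant. -/
theorem eq_of_continuousOn_of_cexp_eq {X : Type*} [TopologicalSpace X] {s : Set X}
    (hs : IsPreconnected s) {g : X → ℂ} (hg : ContinuousOn g s)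
    (he : ∀ x ∈ s, ∀ y ∈ s, Complex.exp (g x) = Complex.exp (g y)) {x y : X}
    (hx : x ∈ s) (hy : y ∈ s) : g x = g y := by
  have hc := Complex.isCoveringMap_exp
  exact hc.isSeparatedMap.constOn_of_comp hc.isLocalHomeomorph.isLocallyInjective hs hg
    (fun a ha b hb => Subtype.ext (he a ha b hb)) hx hy

/-- A nowhere vanishing continuous function on the plane has a continuous logarithm. -/
theorem exists_continuous_log {f : ℝ × ℝ → ℂ} (hf : Continuous f) (h0 : ∀ p, f p ≠ 0) :
    ∃ l : ℝ × ℝ → ℂ, Continuous l ∧ ∀ p, Complex.exp (l p) = f p := by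
  have : SimplyConnectedSpace (ℝ × ℝ) := SimplyConnectedSpace.ofContractible _
  obtain ⟨F, ⟨-, hF⟩, -⟩ := Complex.isCoveringMap_exp.existsUnique_continuousMap_lifts
    (⟨fun p => ⟨f p, h0 p⟩, hf.subtype_mk _⟩ : C(ℝ × ℝ, {z : ℂ // z ≠ 0})) 0
    (Complex.log (f 0)) (Subtype.ext (Complex.exp_log (h0 0)))
  exact ⟨F, F.continuous, fun p => congrArg Subtype.val (congrFun hF p)⟩

/-- A continuous angle that stays in the upper half plane does not turn by `3π`. -/
theorem abs_sub_lt_of_sin_nonneg {T : ℝ} (hT : 0 < T) {g : ℝ → ℝ} (hg : Continuous g)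
    (hs : ∀ h ∈ Ioo 0 T, 0 ≤ Real.sin (g h)) : |g T - g 0| < 3 * Real.pi := by
  have hpi := Real.pi_pos
  -- The witness is the first point of `-π/2 + 2πℤ` beyond `u`, at distance at most `2π`. An angle
  -- turning by `3π` would pass through such a point.
  have key : ∀ u : ℝ, ∃ θ, u < θ ∧ θ < u + 3 * Real.pi ∧ Real.sin θ = -1 := by
    intro u
    set x := u / (2 * Real.pi) + 1 / 4 with hx
    have hu : u = (x - 1 / 4) * (2 * Real.pi) := by rw [hx]; field_simp; ring
    have h1 := Int.floor_le x
    have h2 := Int.lt_floor_add_one x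
    refine ⟨-(Real.pi / 2) + ((⌊x⌋ + 1 : ℤ) : ℝ) * (2 * Real.pi), ?_, ?_, ?_⟩
    · push_cast; nlinarith
    · push_cast; nlinarith
    · rw [Real.sin_add_int_mul_two_pi, Real.sin_neg, Real.sin_pi_div_two]
  by_contra! hcon
  rcases le_abs'.1 hcon with hle | hle
  · obtain ⟨θ, h1, h2, h3⟩ := key (g T)
    obtain ⟨h, hh, rfl⟩ := intermediate_value_Ioo' hT.le hg.continuousOn
      (⟨h1, by linarith⟩ : θ ∈ Ioo (g T) (g 0))
    have := hs h hh
    linarith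
  · obtain ⟨θ, h1, h2, h3⟩ := key (g 0)
    obtain ⟨h, hh, rfl⟩ := intermediate_value_Ioo hT.le hg.continuousOn
      (⟨h1, by linarith⟩ : θ ∈ Ioo (g 0) (g T))
    have := hs h hh
    linarith

/-! ### The field of chord directions of a closed curve. -/

/-- The average of `z` over `[s, s + h]`. -/
def chordSlope (z : ℝ → ℂ) (s h : ℝ) : ℂ := ∫ u in (0 : ℝ)..1, z (s + u * h)

theorem continuous_chordSlope {z : ℝ → ℂ} (hz : Continuous z) :
    Continuous fun p : ℝ × ℝ => chordSlope z p.1 p.2 := by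
  unfold chordSlope
  apply intervalIntegral.continuous_parametric_intervalIntegral_of_continuous' (by fun_prop)

theorem mul_chordSlope {c z : ℝ → ℂ} (hz : Continuous z) (hc : ∀ t, HasDerivAt c (z t) t)
    (s h : ℝ) : h * chordSlope z s h = c (s + h) - c s := by
  have := intervalIntegral.integral_eq_sub_of_hasDerivAt (a := 0) (b := 1)
    (f := fun u : ℝ => c (s + u * h)) (f' := fun u => h * z (s + u * h)) (fun u _ => by
      have h1 : HasDerivAt (fun u : ℝ => s + u * h) h u := by
        simpa using ((hasDerivAt_id u).mul_const h).const_add s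
      simpa [comp_def] using (hc (s + u * h)).scomp u h1) (by
      apply Continuous.intervalIntegrable; fun_prop)
  rw [intervalIntegral.integral_const_mul] at this
  simpa [chordSlope] using this

@[simp] theorem chordSlope_zero (z : ℝ → ℂ) (s : ℝ) : chordSlope z s 0 = z s := by
  simp [chordSlope]

/-- A positive multiple of the chord from `s` to `s + h` of a closed curve with period `T` and
velocity `z`, extended continuously to `h = 0` and `h = T`. -/
def chordField (z : ℝ → ℂ) (T s h : ℝ) : ℂ := chordSlope z s h - chordSlope z (s + h) (T - h)

theorem continuous_chordField {z : ℝ → ℂ} (hz : Continuous z) (T : ℝ) :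
    Continuous fun p : ℝ × ℝ => chordField z T p.1 p.2 := by
  have h := continuous_chordSlope hz
  exact h.sub (h.comp (by fun_prop : Continuous fun p : ℝ × ℝ => (p.1 + p.2, T - p.2)))

section Periodic

variable {T : ℝ} {c z : ℝ → ℂ}

theorem chordSlope_periodic (hzp : Periodic z T) (s h : ℝ) :
    chordSlope z (s + T) h = chordSlope z s h := by
  simp only [chordSlope]
  congr 1; ext u
  rw [add_right_comm, hzp]

/-- The chord from `s + h` to `s + T` is the chord from `s` to `s + h` reversed. -/
theorem chordField_add_sub (hzp : Periodic z T) (s h : ℝ) :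
    chordField z T (s + h) (T - h) = -chordField z T s h := by
  simp [chordField, chordSlope_periodic hzp]

/-- The two averages belong to opposite chords, of parameter lengths `h` and `T - h`, and `1/h +
1/(T - h) = T/(h(T - h))`. -/
theorem mul_chordField (hz : Continuous z) (hc : ∀ t, HasDerivAt c (z t) t) (hcp : Periodic c T)
    (s h : ℝ) : ((h * (T - h) : ℝ) : ℂ) * chordField z T s h = T * (c (s + h) - c s) := by
  have h1 := mul_chordSlope hz hc s h
  have h2 := mul_chordSlope hz hc (s + h) (T - h)
  rw [show s + h + (T - h) = s + T by ring, hcp] at h2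
  push_cast at h2 ⊢
  rw [chordField]
  linear_combination (T - h : ℂ) * h1 - h * h2

/-- The second average is over a full period, where it vanishes because the curve closes up. -/
theorem chordField_zero (hT : 0 < T) (hz : Continuous z) (hc : ∀ t, HasDerivAt c (z t) t)
    (hcp : Periodic c T) (s : ℝ) : chordField z T s 0 = z s := by
  have h := mul_chordSlope hz hc s T
  rw [hcp, sub_self, mul_eq_zero] at h
  simp [chordField, h.resolve_left (by exact_mod_cast hT.ne')]

theorem chordField_ne_zero (hT : 0 < T) (hz : Continuous z) (hzp : Periodic z T)
    (hz0 : ∀ t, z t ≠ 0) (hc : ∀ t, HasDerivAt c (z t) t) (hcp : Periodic c T)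
    (hinj : ∀ s h, 0 < h → h < T → c (s + h) ≠ c s) {h : ℝ} (h0 : 0 ≤ h) (h1 : h ≤ T) (s : ℝ) :
    chordField z T s h ≠ 0 := by
  rcases h0.eq_or_lt with rfl | h0
  · rw [chordField_zero hT hz hc hcp]; exact hz0 s
  rcases h1.eq_or_lt with rfl | h1
  · have := chordField_add_sub hzp s h
    rw [sub_self, chordField_zero hT hz hc hcp] at this
    rw [← neg_ne_zero, ← this]
    exact hz0 _
  · intro hF
    have := mul_chordField hz hc hcp s h
    rw [hF, mul_zero, eq_comm, mul_eq_zero, sub_eq_zero] at this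
    exact this.elim (by exact_mod_cast hT.ne') (hinj s h h0 h1)

/-! ### The Umlaufsatz for periodic curves. -/

/-- **Hopf's Umlaufsatz**: the tangent of a simple closed curve turns once. -/
theorem exists_tangent_log (hT : 0 < T) (hz : Continuous z) (hzp : Periodic z T)
    (hz0 : ∀ t, z t ≠ 0) (hc : ∀ t, HasDerivAt c (z t) t) (hcp : Periodic c T)
    (hinj : ∀ s h, 0 < h → h < T → c (s + h) ≠ c s) :
    ∃ l : ℝ → ℂ, Continuous l ∧ (∀ t, Complex.exp (l t) = z t) ∧
      ∃ σ : ℝ, (σ = 1 ∨ σ = -1) ∧ ∀ t, (l (t + T) - l t).im = σ * (2 * Real.pi) := by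
  -- Clamping `h` to `[0, T]` makes the field nonvanishing on the whole plane, where logarithms
  -- exist.
  set r : ℝ → ℝ := fun h => max 0 (min h T) with hr
  have hrc : Continuous r := by fun_prop
  have hr0 : ∀ h, 0 ≤ r h := fun h => le_max_left _ _
  have hrT : ∀ h, r h ≤ T := fun h => max_le hT.le (min_le_right _ _)
  have hrid : ∀ h, 0 ≤ h → h ≤ T → r h = h := fun h h0 h1 => by simp [hr, h0, h1]
  obtain ⟨l, hl, hexp⟩ := exists_continuous_log
    (f := fun p => chordField z T p.1 (r p.2))
    ((continuous_chordField hz T).comp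
      (by fun_prop : Continuous fun p : ℝ × ℝ => (p.1, r p.2)))
    (fun p => chordField_ne_zero hT hz hzp hz0 hc hcp hinj (hr0 _) (hrT _) _)
  -- The change of the logarithm under chord reversal: a logarithm of `-1`, hence constant.
  set g : ℝ × ℝ → ℂ := fun p => l (p.1 + r p.2, T - r p.2) - l p with hg
  have hgc : Continuous g := by fun_prop
  have hgexp : ∀ p, Complex.exp (g p) = -1 := by
    intro p
    have hne := chordField_ne_zero hT hz hzp hz0 hc hcp hinj (hr0 p.2) (hrT p.2) p.1
    rw [hg, Complex.exp_sub, hexp, hexp]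
    simp only
    rw [hrid (T - r p.2) (by linarith [hrT p.2]) (by linarith [hr0 p.2]),
      chordField_add_sub hzp, neg_div, div_self hne]
  have hconst : ∀ p, g p = g 0 := fun p =>
    eq_of_continuousOn_of_cexp_eq isPreconnected_univ hgc.continuousOn
      (fun x _ y _ => by rw [hgexp, hgexp]) (mem_univ p) (mem_univ 0)
  obtain ⟨k, hk⟩ : ∃ k : ℤ, g 0 = Real.pi * Complex.I + k * (2 * Real.pi * Complex.I) := by
    rw [← Complex.exp_eq_exp_iff_exists_int, hgexp, Complex.exp_pi_mul_I]
  have hkim : (g 0).im = (2 * k + 1) * Real.pi := by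
    rw [hk]; simp; ring
  have hr00 : r 0 = 0 := hrid 0 le_rfl hT.le
  have hrTT : r T = T := hrid T hT.le le_rfl
  have hA : ∀ s, l (s, T) - l (s, 0) = g 0 := fun s => by
    rw [← hconst (s, 0)]; simp [hg, hr00]
  have hB : ∀ s, l (s + T, 0) - l (s, T) = g 0 := fun s => by
    rw [← hconst (s, T)]; simp [hg, hrTT]
  have hcc : Continuous c := continuous_iff_continuousAt.2 fun t => (hc t).continuousAt
  -- All chords from a lowest point lie in the closed upper half plane, so their angle turns by less
  -- than `3π`; being `(2k + 1)π`, the turn is `±π`.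
  obtain ⟨s₀, -, hs₀⟩ := isCompact_Icc.exists_isMinOn (nonempty_Icc.2 hT.le)
    (Complex.continuous_im.comp hcc).continuousOn
  have hmin : ∀ t, (c s₀).im ≤ (c t).im := by
    intro t
    obtain ⟨y, hy, hty⟩ := hcp.exists_mem_Ico₀ hT t
    rw [hty]
    exact hs₀ (Ico_subset_Icc_self hy)
  have hlt := abs_sub_lt_of_sin_nonneg hT (g := fun h => (l (s₀, h)).im) (by fun_prop) (by
    intro h hh
    have h1 := congrArg Complex.im (mul_chordField hz hc hcp s₀ h)
    have h2 := hexp (s₀, h)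
    simp only [hrid h hh.1.le hh.2.le] at h2
    rw [← h2, Complex.im_ofReal_mul, Complex.im_ofReal_mul, Complex.exp_im] at h1
    have h3 : 0 < h * (T - h) := mul_pos hh.1 (sub_pos.2 hh.2)
    have h4 : 0 ≤ T * (c (s₀ + h) - c s₀).im :=
      mul_nonneg hT.le (sub_nonneg.2 (hmin _))
    rw [← h1] at h4
    exact nonneg_of_mul_nonneg_right (nonneg_of_mul_nonneg_right h4 h3) (Real.exp_pos _))
  simp only [← Complex.sub_im, hA, hkim, abs_mul, abs_of_pos Real.pi_pos] at hlt
  have hk3 : |(2 * k + 1 : ℝ)| < 3 := lt_of_mul_lt_mul_right hlt Real.pi_pos.le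
  have hk4 : |2 * k + 1| < 3 := by exact_mod_cast hk3
  have hk5 : 2 * k + 1 = 1 ∨ 2 * k + 1 = -1 := by
    rw [abs_lt] at hk4; omega
  refine ⟨fun t => l (t, 0), by fun_prop, fun t => ?_, 2 * k + 1, by exact_mod_cast hk5,
    fun t => ?_⟩
  · rw [hexp]; simp only [hr00]; exact chordField_zero hT hz hc hcp t
  · rw [show l (t + T, 0) - l (t, 0) = g 0 + g 0 by linear_combination hA t + hB t,
      Complex.add_im, hkim]
    ring

end Periodic

/-! ### From the interval to the periodic setting. -/

/-- The integral of the logarithmic derivative of the velocity of a simple closed curve has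
imaginary part `±2π`. -/
theorem exists_integral_im_div_eq {a b : ℝ} (hab : a < b) {c z w : ℝ → ℂ}
    (hc : ∀ t ∈ Icc a b, HasDerivWithinAt c (z t) (Icc a b) t)
    (hz : ∀ t ∈ Icc a b, HasDerivWithinAt z (w t) (Icc a b) t)
    (hw : ContinuousOn w (Icc a b)) (hz0 : ∀ t ∈ Icc a b, z t ≠ 0)
    (hcab : c a = c b) (hzab : z a = z b) (hinj : InjOn c (Ico a b)) :
    ∃ σ : ℝ, (σ = 1 ∨ σ = -1) ∧ ∫ t in a..b, (w t / z t).im = σ * (2 * Real.pi) := by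
  set T := b - a with hTdef
  have hT : 0 < T := sub_pos.2 hab
  have : Fact (0 < T) := ⟨hT⟩
  have haT : a + T = b := by rw [hTdef]; ring
  have hzc : ContinuousOn z (Icc a b) := fun t ht => (hz t ht).continuousWithinAt
  have hcc : ContinuousOn c (Icc a b) := fun t ht => (hc t ht).continuousWithinAt
  set Z : ℝ → ℂ := fun t => AddCircle.liftIco T a z (t : AddCircle T) with hZ
  have hZc : Continuous Z :=
    (AddCircle.liftIco_continuous (by rw [haT, hzab]) (by rwa [haT])).comp
      (AddCircle.continuous_mk' T)
  have hZp : Periodic Z T := fun t => by simp [hZ]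
  have hZIco : ∀ t ∈ Ico a b, Z t = z t := fun t ht =>
    AddCircle.liftIco_coe_apply (by rwa [haT])
  have hZIcc : ∀ t ∈ Icc a b, Z t = z t := by
    intro t ht
    rcases ht.2.eq_or_lt with rfl | h
    · rw [← hzab, ← hZIco a ⟨le_rfl, hab⟩, ← hZp a, haT]
    · exact hZIco t ⟨ht.1, h⟩
  have hmod : ∀ t : ℝ, ∃ s ∈ Ico a b, ∃ n : ℤ, t = s + n * T := fun t =>
    ⟨toIcoMod hT a t, by simpa [haT] using toIcoMod_mem_Ico hT a t, toIcoDiv hT a t, by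
      simp [← zsmul_eq_mul]⟩
  -- As a primitive of the periodic velocity, the extended curve is differentiable also at the
  -- seams; it is periodic because `c a = c b`.
  set C : ℝ → ℂ := fun t => c a + ∫ u in a..t, Z u with hC
  have hCd : ∀ t, HasDerivAt C (Z t) t := fun t =>
    ((hZc.integral_hasStrictDerivAt a t).hasDerivAt).const_add _
  have hCIcc : ∀ t ∈ Icc a b, C t = c t := by
    intro t ht
    have hsub : Icc a t ⊆ Icc a b := Icc_subset_Icc_right ht.2
    have := intervalIntegral.integral_eq_sub_of_hasDerivAt_of_le ht.1 (hcc.mono hsub)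
      (f' := Z) (fun x hx => by
        have hx' : x ∈ Icc a b := hsub (Ioo_subset_Icc_self hx)
        rw [hZIcc x hx']
        exact (hc x hx').hasDerivAt (Icc_mem_nhds hx.1 (hx.2.trans_le ht.2)))
      (hZc.intervalIntegrable _ _)
    simp [hC, this]
  have hCp : Periodic C T := by
    intro t
    have h1 := intervalIntegral.integral_add_adjacent_intervals
      (hZc.intervalIntegrable (μ := MeasureTheory.volume) a t)
      (hZc.intervalIntegrable t (t + T))
    have h2 := hCIcc b ⟨hab.le, le_rfl⟩
    rw [← hcab] at h2
    simp only [hC, ← h1]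
    rw [hZp.intervalIntegral_add_eq t a, haT]
    linear_combination h2
  have hCZ : ∀ t (n : ℤ), C (t + n * T) = C t := fun t n => hCp.int_mul n t
  have hCinj : ∀ s h, 0 < h → h < T → C (s + h) ≠ C s := by
    intro s h h0 h1 he
    obtain ⟨s, hs, n, rfl⟩ := hmod s
    rw [add_right_comm, hCZ, hCZ, hCIcc s (Ico_subset_Icc_self hs)] at he
    rcases lt_or_ge (s + h) b with hb | hb
    · have hm : s + h ∈ Ico a b := ⟨by linarith [hs.1], hb⟩
      rw [hCIcc _ (Ico_subset_Icc_self hm)] at he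
      linarith [hinj hm hs he]
    · have hm : s + h - T ∈ Ico a b := ⟨by linarith, by linarith [hs.2]⟩
      rw [← sub_add_cancel (s + h) T, hCp, hCIcc _ (Ico_subset_Icc_self hm)] at he
      linarith [hinj hm hs he]
  obtain ⟨l, hl, hexp, σ, hσ, hturn⟩ := exists_tangent_log hT hZc hZp
    (fun t => by
      obtain ⟨s, hs, n, rfl⟩ := hmod t
      rw [show Z (s + n * T) = Z s from hZp.int_mul n s, hZIco s hs]
      exact hz0 s (Ico_subset_Icc_self hs)) hCd hCp hCinj
  refine ⟨σ, hσ, ?_⟩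
  set q : ℝ → ℂ := fun t => w t / z t with hq
  have hqc : ContinuousOn q (Icc a b) := hw.div hzc hz0
  have hqi : IntervalIntegrable q MeasureTheory.volume a b :=
    hqc.intervalIntegrable_of_Icc hab.le
  -- Constant extension beyond `[a, b]` gives a primitive `Q` on the whole line.
  set r : ℝ → ℂ := fun t => q (projIcc a b hab.le t) with hr
  have hrc : Continuous r :=
    hqc.comp_continuous (continuous_subtype_val.comp continuous_projIcc) (fun t => Subtype.prop _)
  have hrq : ∀ t ∈ Icc a b, r t = q t := fun t ht => by simp [hr, projIcc_of_mem hab.le ht]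
  set Q : ℝ → ℂ := fun t => ∫ u in a..t, r u with hQ
  have hQd : ∀ t, HasDerivAt Q (r t) t := fun t => (hrc.integral_hasStrictDerivAt a t).hasDerivAt
  have hQc : Continuous Q := continuous_iff_continuousAt.2 fun t => (hQd t).continuousAt
  -- As `Q' = z'/z`, the product `z exp (-Q)` is constant. Thus `Q` and the tangent logarithm `l`
  -- differ by a constant and have the same increment.
  have hcst := constant_of_has_deriv_right_zero (f := fun t => z t * Complex.exp (-Q t))
    (hzc.mul (by fun_prop)) (a := a) (b := b) (by
      intro t ht
      have ht' := Ico_subset_Icc_self ht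
      have h1 : HasDerivWithinAt (fun t => z t * Complex.exp (-Q t))
          (w t * Complex.exp (-Q t) + z t * (Complex.exp (-Q t) * -r t)) (Icc a b) t :=
        (hz t ht').mul ((hQd t).neg.cexp.hasDerivWithinAt)
      have h2 : w t * Complex.exp (-Q t) + z t * (Complex.exp (-Q t) * -r t) = 0 := by
        have := hz0 t ht'
        rw [hrq t ht', hq]
        field_simp
        ring
      rw [h2] at h1
      exact h1.mono_of_mem_nhdsWithin (Icc_mem_nhdsGE_of_mem ht))
  have hexpz : ∀ t ∈ Icc a b, Complex.exp (l t - Q t) = z t * Complex.exp (-Q t) := by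
    intro t ht
    rw [sub_eq_add_neg, Complex.exp_add, hexp, hZIcc t ht]
  have ha : a ∈ Icc a b := left_mem_Icc.2 hab.le
  have hb : b ∈ Icc a b := right_mem_Icc.2 hab.le
  have hlQ : l b - Q b = l a - Q a :=
    eq_of_continuousOn_of_cexp_eq isPreconnected_Icc
      (g := fun t => l t - Q t) (hl.sub hQc).continuousOn
      (fun x hx y hy => by rw [hexpz x hx, hexpz y hy, hcst x hx, hcst y hy]) hb ha
  have hQa : Q a = 0 := by simp [hQ]
  have hQb : Q b = ∫ t in a..b, q t :=
    intervalIntegral.integral_congr fun t ht => hrq t (by rwa [uIcc_of_le hab.le] at ht)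
  have him : ∫ t in a..b, (q t).im = (∫ t in a..b, q t).im :=
    Complex.imCLM.intervalIntegral_comp_comm hqi
  rw [him, ← hQb, ← hturn a, haT]
  congr 1
  linear_combination hQa - hlQ

/-! ### Velocity and length of parallel curves. -/

namespace PlaneCurve

theorem norm_sq_eq (v : Plane) : ‖v‖ ^ 2 = v 0 ^ 2 + v 1 ^ 2 := by
  simp [EuclideanSpace.norm_sq_eq]

/-- The identification of the plane with the complex numbers. -/
def toComplex : Plane →L[ℝ] ℂ :=
  Complex.orthonormalBasisOneI.repr.symm.toContinuousLinearEquiv.toContinuousLinearMap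

theorem toComplex_apply (v : Plane) : toComplex v = v 0 + v 1 * Complex.I := rfl

theorem toComplex_injective : Injective toComplex :=
  Complex.orthonormalBasisOneI.repr.symm.injective

theorem im_toComplex_div (u v : Plane) :
    (toComplex v / toComplex u).im = det u v / ‖u‖ ^ 2 := by
  rw [norm_sq_eq, Complex.div_im, Complex.normSq_apply]
  simp only [toComplex_apply, det, Complex.add_re, Complex.add_im, Complex.ofReal_re,
    Complex.ofReal_im, Complex.re_ofReal_mul, Complex.im_ofReal_mul, Complex.I_re, Complex.I_im]
  ring

theorem hasDerivWithinAt_of_apply {f : ℝ → Plane} {f' : Plane} {s : Set ℝ} {t : ℝ}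
    (h0 : HasDerivWithinAt (fun t => f t 0) (f' 0) s t)
    (h1 : HasDerivWithinAt (fun t => f t 1) (f' 1) s t) : HasDerivWithinAt f f' s t := by
  have h : HasDerivWithinAt (fun t i => f t i) (fun i => f' i) s t :=
    hasDerivWithinAt_pi.2 fun i => by fin_cases i <;> assumption
  exact (EuclideanSpace.equiv (Fin 2) ℝ).symm.hasFDerivAt.comp_hasDerivWithinAt t h

theorem hasDerivWithinAt_apply {f : ℝ → Plane} {f' : Plane} {s : Set ℝ} {t : ℝ}
    (h : HasDerivWithinAt f f' s t) (i : Fin 2) :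
    HasDerivWithinAt (fun t => f t i) (f' i) s t :=
  (EuclideanSpace.proj (𝕜 := ℝ) i).hasFDerivAt.comp_hasDerivWithinAt t h

/-- The rotated unit vector of a plane-valued function moves along the function itself. -/
theorem hasDerivWithinAt_rotate_normalize {v : ℝ → Plane} {v' : Plane} {s : Set ℝ} {t : ℝ}
    (hv : HasDerivWithinAt v v' s t) (h0 : v t ≠ 0) :
    HasDerivWithinAt (fun t => rotate (‖v t‖⁻¹ • v t)) (-(det (v t) v' / ‖v t‖ ^ 3) • v t) s t := by
  have hn : 0 < ‖v t‖ := norm_pos_iff.2 h0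
  have hsq := norm_sq_eq (v t)
  have hp := hasDerivWithinAt_apply hv 0
  have hq := hasDerivWithinAt_apply hv 1
  have hN : HasDerivWithinAt (fun t => ‖v t‖) ((v t 0 * v' 0 + v t 1 * v' 1) / ‖v t‖) s t := by
    have h := ((hp.pow 2).add (hq.pow 2)).sqrt (by
      simp only [Pi.add_apply, Pi.pow_apply]; rw [← hsq]; positivity)
    convert! h using 1
    · ext x; simp [EuclideanSpace.norm_eq]
    · simp only [Pi.add_apply, Pi.pow_apply]
      rw [← hsq, Real.sqrt_sq hn.le]; field_simp; push_cast; ring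
  have hNi := hN.inv hn.ne'
  apply hasDerivWithinAt_of_apply
  · convert! (hNi.mul hq).neg using 1
    simp only [PiLp.smul_apply, smul_eq_mul, det, Pi.inv_apply]
    field_simp
    rw [hsq]
    ring
  · convert! hNi.mul hp using 1
    simp only [PiLp.smul_apply, smul_eq_mul, det, Pi.inv_apply]
    field_simp
    rw [hsq]
    ring

namespace IsRegularClosed

variable {a b : ℝ} {α : ℝ → Plane} (hα : IsRegularClosed a b α)
include hα

theorem contDiffOn_velocity : ContDiffOn ℝ 1 (velocity a b α) (Icc a b) :=
  hα.contDiffOn.derivWithin (uniqueDiffOn_Icc hα.lt) (by norm_num)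

theorem continuousOn_velocity : ContinuousOn (velocity a b α) (Icc a b) :=
  hα.contDiffOn_velocity.continuousOn

theorem continuousOn_acceleration : ContinuousOn (acceleration a b α) (Icc a b) :=
  hα.contDiffOn_velocity.continuousOn_derivWithin (uniqueDiffOn_Icc hα.lt) le_rfl

theorem hasDerivWithinAt {t : ℝ} (ht : t ∈ Icc a b) :
    HasDerivWithinAt α (velocity a b α t) (Icc a b) t :=
  (hα.contDiffOn.differentiableOn (by norm_num) t ht).hasDerivWithinAt

theorem hasDerivWithinAt_velocity {t : ℝ} (ht : t ∈ Icc a b) :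
    HasDerivWithinAt (velocity a b α) (acceleration a b α t) (Icc a b) t :=
  (hα.contDiffOn_velocity.differentiableOn (by norm_num) t ht).hasDerivWithinAt

theorem continuousOn_curvature : ContinuousOn (curvature a b α) (Icc a b) := by
  have hv := hα.continuousOn_velocity
  have hw := hα.continuousOn_acceleration
  have happ : ∀ {f : ℝ → Plane} (i : Fin 2), ContinuousOn f (Icc a b) →
      ContinuousOn (fun t => f t i) (Icc a b) := fun i hf =>
    (EuclideanSpace.proj (𝕜 := ℝ) i).continuous.comp_continuousOn hf
  exact (((happ 0 hv).mul (happ 1 hw)).sub ((happ 1 hv).mul (happ 0 hw))).div (hv.norm.pow 3)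
    fun t ht => pow_ne_zero 3 (norm_ne_zero_iff.2 (hα.velocity_ne_zero t ht))

theorem velocity_parallel (ε : ℝ) {t : ℝ} (ht : t ∈ Icc a b) :
    velocity a b (parallel a b α ε) t = (1 - ε * curvature a b α t) • velocity a b α t := by
  have h := (hα.hasDerivWithinAt ht).add ((hasDerivWithinAt_rotate_normalize
    (hα.hasDerivWithinAt_velocity ht) (hα.velocity_ne_zero t ht)).const_smul ε)
  refine (h.derivWithin (uniqueDiffOn_Icc hα.lt t ht)).trans ?_
  rw [curvature]
  module

/-- The length of a parallel curve within the radius of curvature. -/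
theorem length_parallel_sub {ε : ℝ} (h0 : 0 ≤ ε)
    (hε : ∀ t ∈ Icc a b, 0 < curvature a b α t → ε ≤ 1 / curvature a b α t) :
    length a b (parallel a b α ε) - length a b α
      = -ε * ∫ t in a..b, curvature a b α t * ‖velocity a b α t‖ := by
  have hle := hα.lt.le
  have hv := hα.continuousOn_velocity.norm
  have hi := hv.intervalIntegrable_of_Icc (μ := MeasureTheory.volume) hle
  have hki : IntervalIntegrable (fun t => curvature a b α t * ‖velocity a b α t‖)
      MeasureTheory.volume a b :=
    (hα.continuousOn_curvature.mul hv).intervalIntegrable_of_Icc hle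
  have hpar : length a b (parallel a b α ε) = ∫ t in a..b,
      (‖velocity a b α t‖ + -ε * (curvature a b α t * ‖velocity a b α t‖)) := by
    refine intervalIntegral.integral_congr fun t ht => ?_
    rw [uIcc_of_le hle] at ht
    -- The only use of the bound on `ε`: it removes the absolute value from `|1 - εκ|`.
    have hk : 0 ≤ 1 - ε * curvature a b α t := by
      rcases le_or_gt (curvature a b α t) 0 with hk | hk
      · nlinarith
      · linarith [(le_div_iff₀ hk).1 (hε t ht hk)]
    simp only [hα.velocity_parallel ε ht, norm_smul, Real.norm_of_nonneg hk]
    ring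
  rw [hpar, intervalIntegral.integral_add hi (hki.const_mul _),
    intervalIntegral.integral_const_mul, length]
  ring

theorem exists_pos_le_radius : ∃ ε₀ : ℝ, 0 < ε₀ ∧ ∀ ε ≤ ε₀, ∀ t ∈ Icc a b,
    0 < curvature a b α t → ε ≤ 1 / curvature a b α t := by
  obtain ⟨M, hM⟩ := isCompact_Icc.bddAbove_image hα.continuousOn_curvature
  refine ⟨1 / (|M| + 1), by positivity, fun ε hε t ht hk => hε.trans ?_⟩
  have := hM (mem_image_of_mem _ ht)
  exact one_div_le_one_div_of_le hk (by linarith [le_abs_self M])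

end IsRegularClosed

/-! ### Total curvature and conclusion. -/

/-- The total curvature of a simple closed plane curve is `±2π`. -/
theorem IsSimpleRegularClosed.exists_total_curvature {a b : ℝ} {α : ℝ → Plane}
    (hα : IsSimpleRegularClosed a b α) : ∃ σ : ℝ, (σ = 1 ∨ σ = -1) ∧
      ∫ t in a..b, curvature a b α t * ‖velocity a b α t‖ = σ * (2 * Real.pi) := by
  have hr := hα.toIsRegularClosed
  obtain ⟨σ, hσ, h⟩ := exists_integral_im_div_eq hα.lt
    (c := fun t => toComplex (α t)) (z := fun t => toComplex (velocity a b α t))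
    (w := fun t => toComplex (acceleration a b α t))
    (fun t ht => toComplex.hasFDerivAt.comp_hasDerivWithinAt t (hr.hasDerivWithinAt ht))
    (fun t ht => toComplex.hasFDerivAt.comp_hasDerivWithinAt t (hr.hasDerivWithinAt_velocity ht))
    (toComplex.continuous.comp_continuousOn hr.continuousOn_acceleration)
    (fun t ht => (map_ne_zero_iff toComplex toComplex_injective).2 (hα.velocity_ne_zero t ht))
    (congrArg toComplex hα.closed) (congrArg toComplex hα.velocity_closed)
    (toComplex_injective.comp_injOn hα.injOn)
  refine ⟨σ, hσ, h ▸ intervalIntegral.integral_congr fun t ht => ?_⟩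
  rw [uIcc_of_le hα.lt.le] at ht
  have hn := norm_ne_zero_iff.2 (hα.velocity_ne_zero t ht)
  simp only [im_toComplex_div, curvature]
  field_simp

end PlaneCurve

end

theorem corollary5 (a b : ℝ) (α : ℝ → PlaneCurve.Plane)
    (hα : PlaneCurve.IsSimpleRegularClosed a b α) :
    ∃ σ : ℝ, (σ = 1 ∨ σ = -1) ∧
      (∀ ε : ℝ, 0 ≤ ε →
        (∀ t ∈ Set.Icc a b, 0 < PlaneCurve.curvature a b α t →
          ε ≤ 1 / PlaneCurve.curvature a b α t) →
        PlaneCurve.length a b (PlaneCurve.parallel a b α ε) - PlaneCurve.length a b α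
          = σ * (2 * Real.pi * ε)) ∧
      (∃ ε₀ : ℝ, 0 < ε₀ ∧ ∀ ε : ℝ, 0 ≤ ε → ε ≤ ε₀ →
        PlaneCurve.length a b (PlaneCurve.parallel a b α ε) - PlaneCurve.length a b α
          = σ * (2 * Real.pi * ε)) := by
  obtain ⟨τ, hτ, htotal⟩ := hα.exists_total_curvature
  have key : ∀ ε : ℝ, 0 ≤ ε →
      (∀ t ∈ Set.Icc a b, 0 < PlaneCurve.curvature a b α t →
        ε ≤ 1 / PlaneCurve.curvature a b α t) →
      PlaneCurve.length a b (PlaneCurve.parallel a b α ε) - PlaneCurve.length a b α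
        = -τ * (2 * Real.pi * ε) := by
    intro ε h0 hε
    rw [hα.toIsRegularClosed.length_parallel_sub h0 hε, htotal]
    ring
  obtain ⟨ε₀, hpos, hε₀⟩ := hα.toIsRegularClosed.exists_pos_le_radius
  -- The sign is opposite to that of the turning: positive total curvature shortens the left
  -- parallel curve.
  refine ⟨-τ, ?_, key, ε₀, hpos, fun ε h0 hε => key ε h0 (hε₀ ε hε)⟩
  rcases hτ with rfl | rfl <;> simp
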